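/- Let $N\in\mathbb N$, $K\ge 0$, natural frequencies $\Omega=(\Omega_1,\dots,\Omega_N)\in\mathbb R^N$ and an initial configuration $\Theta_0\in\mathbb R^N$. For $\theta\in\mathbb R$ let $\bar\theta\in(-\pi,\pi]$ be its representative modulo $2\pi$ and $|\theta|_o:=|\bar\theta|$. Put $$h(\theta)=\frac{\sin\theta}{|\theta|_o}\ (\theta\notin 2\pi\mathbb Z),\quad h(\theta)=0\ (\theta\in2\pi\mathbb Z),\qquad h_\varepsilon(\theta)=\frac{\sin\theta}{(\varepsilon^2+|\theta|_o^2)^{1/2}}\quad(\varepsilon>0)$$ (the critical exponent $\alpha=\tfrac12$), and $$H_i(\Theta)=\Omega_i+\frac KN\sum_{j=1}^N h(\theta_j-\theta_i),\qquad H_i^\varepsilon(\Theta)=\Omega_i+\frac KN\sum_{j=1}^N h_\varepsilon(\theta_j-\theta_i).$$ Let $\mathcal H$ be the Filippov set-valued map of $H$, i.e. $\mathcal H(\Theta)=\bigcap_{\delta>0}\bigcap_{|\mathcal N|=0}\overline{\mathrm{co}}\,\big(H(B_\delta(\Theta)\setminus\mathcal N)\big)$, where $\mathcal N$ runs over the Lebesgue-null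 sets. For every $\varepsilon>0$ let $\Theta^\varepsilon=(\theta^\varepsilon_1,\dots,\theta^\varepsilon_N):[0,\infty)\to\mathbb R^N$ be the classical solution of $\dot\Theta^\varepsilon=H^\varepsilon(\Theta^\varepsilon)$, $\Theta^\varepsilon(0)=\Theta_0$. Then: 1. With $C_\Omega:=\big(\sum_{i=1}^N\Omega_i^2\big)^{1/2}$, one has $|\dot\theta_i^\varepsilon(t)|\le C_\Omega+K$ for all $\varepsilon>0$, $t\ge0$ and $i=1,\dots,N$. In particular $\{\Theta^\varepsilon\}_{\varepsilon>0}$ is bounded in $W^{1,\infty}((0,T);\mathbb R^N)$ for every $T>0$. 2. Let $\varepsilon_n>0$, $\varepsilon_n\to0$, and suppose that $\Theta^{\varepsilon_n}$ converges to $\Theta$ weakly-* in $W^{1,\infty}_{loc}$; that is, for every $T>0$, $\Theta\in W^{1,\infty}((0,T);\mathbb R^N)$, $\Theta^{\varepsilon_n}\overset{*}{\rightharpoonup}\Theta$ and $\dot\Theta^{\varepsilon_n}\overset{*}{\rightharpoonup}\dot\Theta$ in $L^\infty((0,T);\mathbb R^N)$, where $\dot\Theta$ is the weak derivative. Then $$\dot\Theta(t)\in\mathcal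 H(\Theta(t))\quad\text{for a.e. }t\ge0,$$ and $\Theta$ (after modification on a null set) is a Filippov solution of $\dot\Theta=H(\Theta)$ with initial datum $\Theta_0$: it is absolutely continuous on every $[0,T]$, $\Theta(0)=\Theta_0$, and its a.e. derivative belongs to $\mathcal H(\Theta(t))$ for a.e. $t\ge0$. -/

import Mathlib

open MeasureTheory Set Filter Topology
open scoped ENNReal ContDiff

noncomputable section

namespace SingularKuramoto

/-- Representative of `θ` modulo `2π` in `(-π, π]`. -/
def bar (θ : ℝ) : ℝ := toIocMod Real.two_pi_pos (-Real.pi) θ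

/-- Orthodromic distance (to zero) on the unit circle, `|θ|_o = |bar θ|`. -/
def orthodromic (θ : ℝ) : ℝ := |bar θ|

/-- Singular kernel `h(θ) = sin θ / |θ|_o ^ (2α)`; at `θ ∈ 2πℤ` its value is `0`
(for `α > 0`). -/
def kernel (α θ : ℝ) : ℝ := Real.sin θ / orthodromic θ ^ (2 * α)

/-- Regularized kernel `h_ε(θ) = sin θ / (ε² + |θ|_o²) ^ α`. -/
def regKernel (α ε θ : ℝ) : ℝ := Real.sin θ / (ε ^ 2 + orthodromic θ ^ 2) ^ α

/-- The Kuramoto vector field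
`H_i(Θ) = Ω_i + (K / N) ∑_j k(θ_j - θ_i)` with interaction kernel `k`. -/
def field {N : ℕ} (Ω : EuclideanSpace ℝ (Fin N)) (K : ℝ) (k : ℝ → ℝ)
    (Θ : EuclideanSpace ℝ (Fin N)) : EuclideanSpace ℝ (Fin N) :=
  WithLp.toLp 2 fun i => Ω i + K / N * ∑ j, k (Θ j - Θ i)

/-- The singular field `H`. -/
def singField {N : ℕ} (Ω : EuclideanSpace ℝ (Fin N)) (K α : ℝ) :
    EuclideanSpace ℝ (Fin N) → EuclideanSpace ℝ (Fin N) :=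
  field Ω K (kernel α)

/-- The regularized field `H^ε`. -/
def regField {N : ℕ} (Ω : EuclideanSpace ℝ (Fin N)) (K α ε : ℝ) :
    EuclideanSpace ℝ (Fin N) → EuclideanSpace ℝ (Fin N) :=
  field Ω K (regKernel α ε)

/-- Global-in-time classical solution on `[0, ∞)` of `x' = F(x)`, `x(0) = x₀`
(the derivative at `0` is one-sided). -/
structure IsClassicalSolution {N : ℕ}
    (F : EuclideanSpace ℝ (Fin N) → EuclideanSpace ℝ (Fin N))
    (x₀ : EuclideanSpace ℝ (Fin N)) (x : ℝ → EuclideanSpace ℝ (Fin N)) : Prop where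
  initial : x 0 = x₀
  hasDeriv : ∀ t, 0 ≤ t → HasDerivWithinAt x (F (x t)) (Ici 0) t

/-- The Filippov set-valued map of `F`:
`⋂_{δ > 0} ⋂_{|𝒩| = 0} closure (co (F (B_δ(x) \ 𝒩)))`. -/
def filippov {N : ℕ} (F : EuclideanSpace ℝ (Fin N) → EuclideanSpace ℝ (Fin N))
    (x : EuclideanSpace ℝ (Fin N)) : Set (EuclideanSpace ℝ (Fin N)) :=
  ⋂ (δ : ℝ) (_ : 0 < δ) (𝒩 : Set (EuclideanSpace ℝ (Fin N))) (_ : volume 𝒩 = 0),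
    closure (convexHull ℝ (F '' (Metric.ball x δ \ 𝒩)))

/-- Global-in-time solution in Filippov's sense of `x' = F(x)`, `x(0) = x₀`: an absolutely
continuous curve whose derivative lies in the Filippov map of `F` for almost every `t ≥ 0`. -/
structure IsFilippovSolution {N : ℕ}
    (F : EuclideanSpace ℝ (Fin N) → EuclideanSpace ℝ (Fin N))
    (x₀ : EuclideanSpace ℝ (Fin N)) (x : ℝ → EuclideanSpace ℝ (Fin N)) : Prop where
  initial : x 0 = x₀
  absCont : ∀ T, 0 < T → AbsolutelyContinuousOnInterval x 0 T
  inclusion : ∀ᵐ t ∂(volume.restrict (Ici (0 : ℝ))), ∃ v ∈ filippov F (x t), HasDerivAt x v t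

/-- `u ∈ W^{1,∞}((0, T); ℝᴺ)` for every `T > 0`, with weak derivative `v`. -/
structure MemW1InfLoc {N : ℕ} (u v : ℝ → EuclideanSpace ℝ (Fin N)) : Prop where
  memLp : ∀ T, 0 < T → MemLp u ∞ (volume.restrict (Ioo 0 T))
  memLp_deriv : ∀ T, 0 < T → MemLp v ∞ (volume.restrict (Ioo 0 T))
  weakDeriv : ∀ φ : ℝ → ℝ, ContDiff ℝ ∞ φ → HasCompactSupport φ → tsupport φ ⊆ Ioi 0 →
    ∫ t in Ioi (0 : ℝ), deriv φ t • u t = - ∫ t in Ioi (0 : ℝ), φ t • v t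

/-- Weak-* convergence in `L^∞((0, T); ℝᴺ)` (as the dual of `L¹((0, T); ℝᴺ)`)
for every `T > 0`. -/
def TendstoWeakStarLinf {N : ℕ} (u : ℕ → ℝ → EuclideanSpace ℝ (Fin N))
    (u' : ℝ → EuclideanSpace ℝ (Fin N)) : Prop :=
  ∀ T, 0 < T → ∀ g : ℝ → EuclideanSpace ℝ (Fin N),
    Integrable g (volume.restrict (Ioo 0 T)) →
      Tendsto (fun n => ∫ t in Ioo 0 T, inner ℝ (g t) (u n t)) atTop
        (𝓝 (∫ t in Ioo 0 T, inner ℝ (g t) (u' t)))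

/-- The functions `u n`, with derivatives `v n`, converge weakly-* in
`W^{1,∞}((0, T); ℝᴺ)` for every `T > 0` to `u'`, with weak derivative `v'`. -/
structure TendstoWeakStarW1InfLoc {N : ℕ} (u v : ℕ → ℝ → EuclideanSpace ℝ (Fin N))
    (u' v' : ℝ → EuclideanSpace ℝ (Fin N)) : Prop where
  memLimit : MemW1InfLoc u' v'
  tendsto : TendstoWeakStarLinf u u'
  tendsto_deriv : TendstoWeakStarLinf v v'

end SingularKuramoto

end

open SingularKuramoto

/-!
The fields `H^ε` are bounded uniformly in `ε`, so the curves `Θ^ε` are uniformly Lipschitz, and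
weak-* convergence of their velocities upgrades to pointwise convergence of the curves themselves.
Let `x` be the limit. At a time `t` where `x` is differentiable, the mean value inequality on a
short interval `[t, s]`, passed first to the limit `n → ∞` and then to `s → t`, shows that every
half-space containing all values `H^ε(y)` for `ε` small and `y` near `x t` also contains `x' t`.

It remains to compare these half-spaces with the Filippov set of `H`. Since the kernels are odd,
`H^ε` tested against `w` is `⟪w, Ω⟫ + ∑ (a_i - a_j) h_ε(θ_j - θ_i)` with `a = K / (2N) • w`. The
upper limit of each summand is its value off collisions and `|a_i - a_j|` at collisions, and
displacing `x` along `-a` makes the corresponding summands of `⟪w, H⟫` converge to all these upper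
limits simultaneously.
-/

namespace SingularKuramoto

open scoped InnerProductSpace NNReal

section Orthodromic

theorem orthodromic_eq_norm (θ : ℝ) : orthodromic θ = ‖(θ : Real.Angle)‖ := by
  change |(θ : Real.Angle).toReal| = _
  have hπ : |(θ : Real.Angle).toReal| ≤ |2 * Real.pi| / 2 := by
    rw [abs_of_pos Real.two_pi_pos, mul_div_cancel_left₀ _ two_ne_zero]
    exact Real.Angle.abs_toReal_le_pi _
  conv_rhs => rw [← Real.Angle.coe_toReal (θ : Real.Angle)]
  exact ((AddCircle.norm_coe_eq_abs_iff _ Real.two_pi_pos.ne').2 hπ).symm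

theorem orthodromic_nonneg (θ : ℝ) : 0 ≤ orthodromic θ := abs_nonneg _

theorem orthodromic_neg (θ : ℝ) : orthodromic (-θ) = orthodromic θ := by
  simp only [orthodromic_eq_norm, Real.Angle.coe_neg, norm_neg]

theorem continuous_orthodromic : Continuous orthodromic := by
  simp only [funext orthodromic_eq_norm]
  exact Real.Angle.continuous_coe.norm

theorem orthodromic_eq_zero_iff {θ : ℝ} : orthodromic θ = 0 ↔ (θ : Real.Angle) = 0 := by
  rw [orthodromic_eq_norm, norm_eq_zero]

theorem orthodromic_of_abs_le_pi {θ : ℝ} (h : |θ| ≤ Real.pi) : orthodromic θ = |θ| := by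
  rw [orthodromic_eq_norm]
  refine (AddCircle.norm_coe_eq_abs_iff _ Real.two_pi_pos.ne').2 ?_
  rwa [abs_of_pos Real.two_pi_pos, mul_div_cancel_left₀ _ two_ne_zero]

theorem abs_sin_le_orthodromic (θ : ℝ) : |Real.sin θ| ≤ orthodromic θ := by
  rw [← Real.Angle.sin_coe, ← Real.Angle.sin_toReal]
  exact Real.abs_sin_le_abs

theorem eventually_orthodromic_add_mul_ne_zero {a : ℝ} (ha : a ≠ 0) (φ : ℝ) :
    ∀ᶠ s in 𝓝[>] (0 : ℝ), orthodromic (φ + s * a) ≠ 0 := by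
  by_cases hφ : orthodromic φ = 0
  · have hsmall : ∀ᶠ s in 𝓝[>] (0 : ℝ), |s * a| < Real.pi :=
      ((by fun_prop : Continuous fun s : ℝ => |s * a|).tendsto' 0 0 (by simp)).mono_left
        nhdsWithin_le_nhds |>.eventually_lt_const Real.pi_pos
    filter_upwards [self_mem_nhdsWithin, hsmall] with s hs hlt
    rw [orthodromic_eq_norm, Real.Angle.coe_add, orthodromic_eq_zero_iff.1 hφ, zero_add,
      ← orthodromic_eq_norm, orthodromic_of_abs_le_pi hlt.le]
    exact abs_ne_zero.2 (mul_ne_zero (ne_of_gt hs) ha)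
  · have hlim : Tendsto (fun s : ℝ => orthodromic (φ + s * a)) (𝓝 0) (𝓝 (orthodromic φ)) :=
      (continuous_orthodromic.comp (by fun_prop : Continuous fun s : ℝ => φ + s * a)).tendsto' _ _
        (by simp)
    exact (hlim.mono_left nhdsWithin_le_nhds).eventually_ne hφ

end Orthodromic

section Kernel

theorem kernel_neg (α θ : ℝ) : kernel α (-θ) = -kernel α θ := by
  simp only [kernel, orthodromic_neg, Real.sin_neg, neg_div]

theorem regKernel_neg (α ε θ : ℝ) : regKernel α ε (-θ) = -regKernel α ε θ := by
  simp only [regKernel, orthodromic_neg, Real.sin_neg, neg_div]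

theorem kernel_add_of_orthodromic_eq_zero {φ : ℝ} (hφ : orthodromic φ = 0) (α s : ℝ) :
    kernel α (φ + s) = kernel α s := by
  simp only [kernel, orthodromic_eq_norm, ← Real.Angle.sin_coe, Real.Angle.coe_add,
    orthodromic_eq_zero_iff.1 hφ, zero_add]

theorem continuousAt_kernel {θ : ℝ} (α : ℝ) (hθ : orthodromic θ ≠ 0) :
    ContinuousAt (kernel α) θ :=
  Real.continuous_sin.continuousAt.div
    (continuous_orthodromic.continuousAt.rpow_const (Or.inl hθ))
    (Real.rpow_pos_of_pos ((orthodromic_nonneg θ).lt_of_ne' hθ) _).ne'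

theorem continuous_regKernel {ε : ℝ} (hε : ε ≠ 0) (α : ℝ) : Continuous (regKernel α ε) := by
  have hpos (θ : ℝ) : 0 < ε ^ 2 + orthodromic θ ^ 2 := by positivity
  exact Real.continuous_sin.div
    ((continuous_const.add (continuous_orthodromic.pow 2)).rpow_const fun θ => Or.inl (hpos θ).ne')
    fun θ => (Real.rpow_pos_of_pos (hpos θ) _).ne'

theorem tendsto_regKernel {ι : Type*} {l : Filter ι} {e y : ι → ℝ} {θ : ℝ} (α : ℝ)
    (he : Tendsto e l (𝓝 0)) (hy : Tendsto y l (𝓝 θ)) (hθ : orthodromic θ ≠ 0) :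
    Tendsto (fun n => regKernel α (e n) (y n)) l (𝓝 (kernel α θ)) := by
  have hpos : 0 < orthodromic θ := (orthodromic_nonneg θ).lt_of_ne' hθ
  have hbase : Tendsto (fun n => e n ^ 2 + orthodromic (y n) ^ 2) l (𝓝 (orthodromic θ ^ 2)) := by
    simpa using (he.pow 2).add (((continuous_orthodromic.tendsto θ).comp hy).pow 2)
  have hden := hbase.rpow_const (p := α) (Or.inl (pow_pos hpos 2).ne')
  rw [← Real.rpow_natCast_mul hpos.le, Nat.cast_ofNat] at hden
  exact ((Real.continuous_sin.tendsto θ).comp hy).div hden (Real.rpow_pos_of_pos hpos _).ne'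

theorem abs_regKernel_half_le_one (ε θ : ℝ) : |regKernel (1 / 2) ε θ| ≤ 1 := by
  rw [regKernel, ← Real.sqrt_eq_rpow, abs_div, abs_of_nonneg (Real.sqrt_nonneg _)]
  refine div_le_one_of_le₀ ((abs_sin_le_orthodromic θ).trans ?_) (Real.sqrt_nonneg _)
  exact Real.le_sqrt_of_sq_le (le_add_of_nonneg_left (sq_nonneg ε))

theorem mul_kernel_half_mul {a s : ℝ} (hs : 0 < s) (h : |s * a| ≤ Real.pi) :
    a * kernel (1 / 2) (s * a) = |a| * Real.sinc (s * a) := by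
  rcases eq_or_ne a 0 with rfl | ha
  · simp
  have ha' : |a| ≠ 0 := abs_ne_zero.2 ha
  rw [kernel, mul_one_div_cancel two_ne_zero, Real.rpow_one, orthodromic_of_abs_le_pi h,
    Real.sinc_of_ne_zero (mul_ne_zero hs.ne' ha), abs_mul, abs_of_pos hs]
  field_simp
  rw [sq_abs, mul_comm]

end Kernel

section KernelEnvelope

/-- The essential upper limit of `a * h` at `φ`, where `h` is the singular kernel with critical
exponent `α = 1 / 2`: at `φ ∈ 2πℤ` the kernel jumps between `-1` and `1`. -/
noncomputable def kernelEnvelope (a φ : ℝ) : ℝ :=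
  if orthodromic φ = 0 then |a| else a * kernel (1 / 2) φ

theorem tendsto_max_mul_regKernel_kernelEnvelope {ι : Type*} {l : Filter ι} {e y : ι → ℝ} {φ : ℝ}
    (a : ℝ) (he : Tendsto e l (𝓝 0)) (hy : Tendsto y l (𝓝 φ)) :
    Tendsto (fun n => max (a * regKernel (1 / 2) (e n) (y n)) (kernelEnvelope a φ)) l
      (𝓝 (kernelEnvelope a φ)) := by
  unfold kernelEnvelope
  split_ifs with hφ
  · have hle (n : ι) : a * regKernel (1 / 2) (e n) (y n) ≤ |a| := by
      refine (le_abs_self _).trans ?_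
      rw [abs_mul]
      exact mul_le_of_le_one_right (abs_nonneg a) (abs_regKernel_half_le_one _ _)
    simpa only [max_eq_right (hle _)] using tendsto_const_nhds
  · simpa only [max_self] using ((tendsto_regKernel (1 / 2) he hy hφ).const_mul a).max
      (tendsto_const_nhds (x := a * kernel (1 / 2) φ))

theorem tendsto_mul_kernel_kernelEnvelope (a φ : ℝ) :
    Tendsto (fun s => a * kernel (1 / 2) (φ + s * a)) (𝓝[>] 0) (𝓝 (kernelEnvelope a φ)) := by
  have hmul : Tendsto (fun s : ℝ => s * a) (𝓝[>] 0) (𝓝 0) :=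
    ((continuous_mul_const a).tendsto' 0 0 (zero_mul a)).mono_left nhdsWithin_le_nhds
  unfold kernelEnvelope
  split_ifs with hφ
  · simp only [kernel_add_of_orthodromic_eq_zero hφ]
    have hsinc : Tendsto (fun s : ℝ => |a| * Real.sinc (s * a)) (𝓝[>] 0) (𝓝 |a|) := by
      simpa using ((Real.continuous_sinc.tendsto 0).comp hmul).const_mul |a|
    refine hsinc.congr' ?_
    filter_upwards [self_mem_nhdsWithin,
      hmul.abs.eventually_lt_const (abs_zero.trans_lt Real.pi_pos)] with s hs hlt
    exact (mul_kernel_half_mul hs hlt.le).symm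
  · have hadd : Tendsto (fun s : ℝ => φ + s * a) (𝓝[>] 0) (𝓝 φ) := by
      simpa using hmul.const_add φ
    exact ((continuousAt_kernel _ hφ).tendsto.comp hadd).const_mul a

theorem eventually_continuousAt_mul_kernel (α a φ : ℝ) :
    ∀ᶠ s in 𝓝[>] (0 : ℝ), ContinuousAt (fun θ => a * kernel α θ) (φ + s * a) := by
  rcases eq_or_ne a 0 with rfl | ha
  · simp only [zero_mul, continuousAt_const, eventually_true]
  · filter_upwards [eventually_orthodromic_add_mul_ne_zero ha φ] with s hs
    exact continuousAt_const.mul (continuousAt_kernel α hs)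

end KernelEnvelope

section Field

variable {N : ℕ}

theorem continuous_field (Ω : EuclideanSpace ℝ (Fin N)) (K : ℝ) {k : ℝ → ℝ} (hk : Continuous k) :
    Continuous (field Ω K k) := by
  refine (PiLp.continuous_toLp 2 _).comp (continuous_pi fun i => ?_)
  exact continuous_const.add (continuous_const.mul
    (continuous_finsetSum _ fun j _ => hk.comp (by fun_prop)))

theorem abs_field_apply_le (Ω x : EuclideanSpace ℝ (Fin N)) (K : ℝ) {k : ℝ → ℝ}
    (hk : ∀ θ, |k θ| ≤ 1) (i : Fin N) : |field Ω K k x i| ≤ ‖Ω‖ + |K| := by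
  have hN : (0 : ℝ) < N := by exact_mod_cast i.pos
  have hsum : |∑ j, k (x j - x i)| ≤ N :=
    calc |∑ j, k (x j - x i)| ≤ ∑ j, |k (x j - x i)| := Finset.abs_sum_le_sum_abs _ _
      _ ≤ ∑ _j : Fin N, 1 := Finset.sum_le_sum fun j _ => hk _
      _ = N := by simp
  calc |field Ω K k x i| ≤ |Ω i| + |K / N * ∑ j, k (x j - x i)| := abs_add_le _ _
    _ = |Ω i| + |K| / N * |∑ j, k (x j - x i)| := by rw [abs_mul, abs_div, abs_of_pos hN]
    _ ≤ ‖Ω‖ + |K| / N * N := by gcongr; exact PiLp.norm_apply_le Ω i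
    _ = ‖Ω‖ + |K| := by rw [div_mul_cancel₀ _ hN.ne']

theorem norm_field_le (Ω x : EuclideanSpace ℝ (Fin N)) (K : ℝ) {k : ℝ → ℝ}
    (hk : ∀ θ, |k θ| ≤ 1) : ‖field Ω K k x‖ ≤ √N * (‖Ω‖ + |K|) := by
  rw [EuclideanSpace.norm_eq, Real.sqrt_le_left (by positivity), mul_pow,
    Real.sq_sqrt (Nat.cast_nonneg N)]
  calc ∑ i, ‖field Ω K k x i‖ ^ 2 ≤ ∑ _i : Fin N, (‖Ω‖ + |K|) ^ 2 :=
        Finset.sum_le_sum fun i _ => pow_le_pow_left₀ (norm_nonneg _)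
          (abs_field_apply_le Ω x K hk i) 2
    _ = N * (‖Ω‖ + |K|) ^ 2 := by simp

theorem two_mul_sum_mul_kernel_sub_of_odd {ι : Type*} [Fintype ι] (w x : ι → ℝ) {k : ℝ → ℝ}
    (hk : ∀ θ, k (-θ) = -k θ) :
    2 * ∑ i, ∑ j, w i * k (x j - x i) = ∑ i, ∑ j, (w i - w j) * k (x j - x i) := by
  have hswap : ∑ i, ∑ j, w j * k (x j - x i) = -∑ i, ∑ j, w i * k (x j - x i) := by
    rw [Finset.sum_comm]
    simp only [← Finset.sum_neg_distrib, ← mul_neg, ← hk, neg_sub]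
  simp only [sub_mul, Finset.sum_sub_distrib, hswap]
  ring

/-- The direction in phase space paired with the test vector `w`: for an odd kernel, the field
tested against `w` is a sum of kernel terms, weighted by the coordinate differences of this
direction. -/
noncomputable def pairingDirection (K : ℝ) (w : EuclideanSpace ℝ (Fin N)) :
    EuclideanSpace ℝ (Fin N) :=
  (K / (2 * N)) • w

theorem inner_field_of_odd (Ω w x : EuclideanSpace ℝ (Fin N)) (K : ℝ) {k : ℝ → ℝ}
    (hk : ∀ θ, k (-θ) = -k θ) :
    ⟪w, field Ω K k x⟫_ℝ = ⟪w, Ω⟫_ℝ +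
      ∑ i, ∑ j, (pairingDirection K w i - pairingDirection K w j) * k (x j - x i) := by
  rw [← two_mul_sum_mul_kernel_sub_of_odd _ _ hk]
  simp only [PiLp.inner_apply, field, pairingDirection, PiLp.smul_apply, smul_eq_mul,
    RCLike.inner_apply, conj_trivial, add_mul, Finset.sum_add_distrib, Finset.mul_sum,
    Finset.sum_mul]
  congr 1
  refine Finset.sum_congr rfl fun i _ => Finset.sum_congr rfl fun j _ => ?_
  field_simp

end Field

section FieldEnvelope

variable {N : ℕ}

/-- The essential upper limit of `y ↦ ⟪w, H y⟫` at `x`, where `H` is the singular field with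
critical exponent `α = 1 / 2`; as a function of `w` it is the support function of the Filippov set
of `H` at `x`. -/
noncomputable def fieldEnvelope (Ω : EuclideanSpace ℝ (Fin N)) (K : ℝ)
    (w x : EuclideanSpace ℝ (Fin N)) : ℝ :=
  ⟪w, Ω⟫_ℝ +
    ∑ i, ∑ j, kernelEnvelope (pairingDirection K w i - pairingDirection K w j) (x j - x i)

theorem eventually_inner_regField_lt {ι : Type*} {l : Filter ι} {e : ι → ℝ}
    {y : ι → EuclideanSpace ℝ (Fin N)} {x : EuclideanSpace ℝ (Fin N)} {K c : ℝ}
    {Ω w : EuclideanSpace ℝ (Fin N)} (he : Tendsto e l (𝓝 0)) (hy : Tendsto y l (𝓝 x))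
    (hc : fieldEnvelope Ω K w x < c) :
    ∀ᶠ n in l, ⟪w, regField Ω K (1 / 2) (e n) (y n)⟫_ℝ < c := by
  have hcoord (i : Fin N) : Tendsto (fun n => y n i) l (𝓝 (x i)) :=
    ((EuclideanSpace.proj (𝕜 := ℝ) i).continuous.tendsto x).comp hy
  have hmajorant := (tendsto_finsetSum Finset.univ fun i _ => tendsto_finsetSum Finset.univ
    fun j _ => tendsto_max_mul_regKernel_kernelEnvelope
      (pairingDirection K w i - pairingDirection K w j) he
      ((hcoord j).sub (hcoord i))).const_add ⟪w, Ω⟫_ℝ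
  filter_upwards [hmajorant.eventually_lt_const hc] with n hn
  rw [regField, inner_field_of_odd _ _ _ _ (regKernel_neg _ _)]
  refine lt_of_le_of_lt ?_ hn
  gcongr
  exact le_max_left _ _

theorem sub_smul_apply_sub (x a : EuclideanSpace ℝ (Fin N)) (s : ℝ) (i j : Fin N) :
    (x - s • a) j - (x - s • a) i = (x j - x i) + s * (a i - a j) := by
  simp only [PiLp.sub_apply, PiLp.smul_apply, smul_eq_mul]
  ring

theorem tendsto_inner_singField_fieldEnvelope (Ω w x : EuclideanSpace ℝ (Fin N)) (K : ℝ) :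
    Tendsto (fun s : ℝ => ⟪w, singField Ω K (1 / 2) (x - s • pairingDirection K w)⟫_ℝ) (𝓝[>] 0)
      (𝓝 (fieldEnvelope Ω K w x)) := by
  simp only [singField, inner_field_of_odd _ _ _ _ (kernel_neg _), sub_smul_apply_sub]
  exact Tendsto.const_add _ (tendsto_finsetSum _ fun i _ => tendsto_finsetSum _ fun j _ =>
    tendsto_mul_kernel_kernelEnvelope _ _)

theorem eventually_continuousAt_inner_singField (Ω w x : EuclideanSpace ℝ (Fin N)) (K α : ℝ) :
    ∀ᶠ s in 𝓝[>] (0 : ℝ),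
      ContinuousAt (fun z => ⟪w, singField Ω K α z⟫_ℝ) (x - s • pairingDirection K w) := by
  have hterm : ∀ᶠ s in 𝓝[>] (0 : ℝ), ∀ i j : Fin N,
      ContinuousAt
        (fun θ => (pairingDirection K w i - pairingDirection K w j) * kernel α θ)
        ((x j - x i) + s * (pairingDirection K w i - pairingDirection K w j)) :=
    eventually_all.2 fun i => eventually_all.2 fun j => eventually_continuousAt_mul_kernel _ _ _
  filter_upwards [hterm] with s hs
  simp only [singField, inner_field_of_odd _ _ _ _ (kernel_neg _)]
  refine continuousAt_const.add (tendsto_finsetSum _ fun i _ => tendsto_finsetSum _ fun j _ => ?_)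
  exact ContinuousAt.comp_of_eq
    (g := fun θ => (pairingDirection K w i - pairingDirection K w j) * kernel α θ)
    (f := fun z : EuclideanSpace ℝ (Fin N) => z j - z i)
    (hs i j) (by fun_prop) (sub_smul_apply_sub _ _ _ _ _)

end FieldEnvelope

section Filippov

theorem frequently_nhds_inf_ae {X : Type*} [TopologicalSpace X] [MeasurableSpace X]
    {μ : Measure X} [μ.IsOpenPosMeasure] {x : X} {p : X → Prop}
    (h : ∃ᶠ y in 𝓝 x, ∀ᶠ z in 𝓝 y, p z) : ∃ᶠ y in 𝓝 x ⊓ ae μ, p y := by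
  intro hnot
  obtain ⟨s, hs, t, ht, hst⟩ := eventually_inf.1 hnot
  obtain ⟨y, hy, hys⟩ := (h.and_eventually (eventually_mem_nhds_iff.2 hs)).exists
  obtain ⟨z, ⟨hpz, hzs⟩, hzt⟩ := mem_closure_iff_nhds.1 (Measure.dense_of_ae ht y) _ (hy.and hys)
  exact hst z ⟨hzs, hzt⟩ hpz

variable {N : ℕ}

theorem mem_filippov_of_frequently_lt_inner
    {F : EuclideanSpace ℝ (Fin N) → EuclideanSpace ℝ (Fin N)} {x v : EuclideanSpace ℝ (Fin N)}
    (h : ∀ w c, c < ⟪w, v⟫_ℝ → ∃ᶠ y in 𝓝 x ⊓ ae volume, c < ⟪w, F y⟫_ℝ) :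
    v ∈ filippov F x := by
  simp only [filippov, mem_iInter]
  intro δ hδ 𝒩 h𝒩
  by_contra hv
  obtain ⟨f, c, hfc, hcv⟩ :=
    geometric_hahn_banach_closed_point (convex_convexHull ℝ _).closure isClosed_closure hv
  obtain ⟨w, rfl⟩ := (InnerProductSpace.toDual ℝ (EuclideanSpace ℝ (Fin N))).surjective f
  simp only [InnerProductSpace.toDual_apply_apply] at hfc hcv
  have hball : ∀ᶠ y in 𝓝 x ⊓ ae volume, y ∈ Metric.ball x δ \ 𝒩 :=
    inter_mem_inf (Metric.ball_mem_nhds x hδ) (compl_mem_ae_iff.2 h𝒩)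
  obtain ⟨y, hlt, hy⟩ := ((h w c hcv).and_eventually hball).exists
  exact lt_asymm hlt (hfc _ (subset_closure (subset_convexHull ℝ _ (mem_image_of_mem F hy))))

/-- The closed convex set in which the values `G i y` asymptotically lie as `i` tends to `l` and `y`
to `x`, encoded as the intersection of the closed half-spaces that eventually contain them. For
bounded `G` it is the closed convex hull of their cluster points. -/
def asymptoticHull {ι E : Type*} [NormedAddCommGroup E] [InnerProductSpace ℝ E] (l : Filter ι)
    (G : ι → E → E) (x : E) : Set E :=
  {v | ∀ w c, (∀ᶠ p in l ×ˢ 𝓝 x, ⟪w, G p.1 p.2⟫_ℝ ≤ c) → ⟪w, v⟫_ℝ ≤ c}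

theorem frequently_lt_inner_singField {Ω w x : EuclideanSpace ℝ (Fin N)} {K c : ℝ}
    (hc : c < fieldEnvelope Ω K w x) :
    ∃ᶠ y in 𝓝 x ⊓ ae volume, c < ⟪w, singField Ω K (1 / 2) y⟫_ℝ := by
  have happroach : Tendsto (fun s : ℝ => x - s • pairingDirection K w) (𝓝[>] 0) (𝓝 x) :=
    ((by fun_prop : Continuous fun s : ℝ => x - s • pairingDirection K w).tendsto' 0 x
      (by simp)).mono_left nhdsWithin_le_nhds
  refine frequently_nhds_inf_ae (happroach.frequently (Eventually.frequently ?_))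
  filter_upwards [(tendsto_inner_singField_fieldEnvelope Ω w x K).eventually_const_lt hc,
    eventually_continuousAt_inner_singField Ω w x K (1 / 2)] with s hlt hcont
  exact hcont.eventually_const_lt hlt

theorem asymptoticHull_regField_subset_filippov {ι : Type*} {l : Filter ι} {e : ι → ℝ}
    (he : Tendsto e l (𝓝 0)) (Ω x : EuclideanSpace ℝ (Fin N)) (K : ℝ) :
    asymptoticHull l (fun i => regField Ω K (1 / 2) (e i)) x ⊆
      filippov (singField Ω K (1 / 2)) x := by
  intro v hv
  refine mem_filippov_of_frequently_lt_inner fun w c hc => frequently_lt_inner_singField ?_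
  refine hc.trans_le (le_of_forall_gt_imp_ge_of_dense fun b hb => hv w b ?_)
  exact (eventually_inner_regField_lt (he.comp tendsto_fst) tendsto_snd hb).mono fun _ => le_of_lt

end Filippov

section LimitVelocity

variable {E : Type*} [NormedAddCommGroup E] [InnerProductSpace ℝ E]

theorem inner_sub_le_of_inner_deriv_le {f f' : ℝ → E} {a b c : ℝ} {w : E} (hab : a ≤ b)
    (hf : ∀ t ∈ Icc a b, HasDerivWithinAt f (f' t) (Icc a b) t)
    (hc : ∀ t ∈ Ioo a b, ⟪w, f' t⟫_ℝ ≤ c) : ⟪w, f b - f a⟫_ℝ ≤ c * (b - a) := by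
  have hderiv (t : ℝ) (ht : t ∈ Ioo a b) : HasDerivAt (fun t => ⟪w, f t⟫_ℝ) ⟪w, f' t⟫_ℝ t := by
    simpa using (hasDerivAt_const t w).inner ℝ
      ((hf t (Ioo_subset_Icc_self ht)).hasDerivAt (Icc_mem_nhds ht.1 ht.2))
  rw [inner_sub_right]
  refine (convex_Icc a b).image_sub_le_mul_sub_of_deriv_le (f := fun t => ⟪w, f t⟫_ℝ) ?_ ?_ ?_
    a (left_mem_Icc.2 hab) b (right_mem_Icc.2 hab) hab
  · exact continuousOn_const.inner fun t ht => (hf t ht).continuousWithinAt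
  · rw [interior_Icc]
    exact fun t ht => (hderiv t ht).differentiableAt.differentiableWithinAt
  · rw [interior_Icc]
    exact fun t ht => (hderiv t ht).deriv.trans_le (hc t ht)

theorem inner_le_of_eventually_inner_sub_le {f : ℝ → E} {v w : E} {t c : ℝ}
    (hf : HasDerivAt f v t) (h : ∀ᶠ s in 𝓝[>] t, ⟪w, f s - f t⟫_ℝ ≤ c * (s - t)) :
    ⟪w, v⟫_ℝ ≤ c := by
  have hslope : Tendsto (slope f t) (𝓝[>] t) (𝓝 v) :=
    (hasDerivWithinAt_iff_tendsto_slope' self_notMem_Ioi).1 hf.hasDerivWithinAt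
  refine le_of_tendsto (tendsto_const_nhds.inner hslope) ?_
  filter_upwards [h, self_mem_nhdsWithin] with s hs hts
  rw [slope_def_module, real_inner_smul_right, inv_mul_le_iff₀ (sub_pos.2 hts), mul_comm]
  exact hs

theorem lipschitzOnWith_of_tendsto {ι X Y : Type*} [PseudoEMetricSpace X] [PseudoEMetricSpace Y]
    {l : Filter ι} [l.NeBot] {f : ι → X → Y} {g : X → Y} {s : Set X} {C : ℝ≥0}
    (hf : ∀ i, LipschitzOnWith C (f i) s) (hlim : ∀ a ∈ s, Tendsto (f · a) l (𝓝 (g a))) :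
    LipschitzOnWith C g s :=
  fun a ha b hb => le_of_tendsto ((hlim a ha).edist (hlim b hb))
    (Eventually.of_forall fun i => hf i ha hb)

theorem tendsto_prod_nhdsWithin_of_lipschitzOnWith {ι X Y : Type*} [PseudoMetricSpace X]
    [PseudoMetricSpace Y] {l : Filter ι} {f : ι → X → Y} {s : Set X} {C : ℝ≥0} {a : X} {b : Y}
    (hf : ∀ i, LipschitzOnWith C (f i) s) (ha : a ∈ s) (hlim : Tendsto (f · a) l (𝓝 b)) :
    Tendsto (fun p : ι × X => f p.1 p.2) (l ×ˢ 𝓝[s] a) (𝓝 b) := by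
  rw [tendsto_iff_dist_tendsto_zero] at hlim ⊢
  have hid : Tendsto (fun p : ι × X => dist p.2 a) (l ×ˢ 𝓝[s] a) (𝓝 0) :=
    tendsto_iff_dist_tendsto_zero.1 (tendsto_snd.mono_right nhdsWithin_le_nhds)
  have hbound : Tendsto (fun p : ι × X => C * dist p.2 a + dist (f p.1 a) b) (l ×ˢ 𝓝[s] a)
      (𝓝 0) := by
    simpa using (hid.const_mul (C : ℝ)).add (hlim.comp tendsto_fst)
  refine squeeze_zero' (Eventually.of_forall fun _ => dist_nonneg) ?_ hbound
  filter_upwards [tendsto_snd.eventually (self_mem_nhdsWithin (s := s) (a := a))] with p hp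
  exact (dist_triangle _ (f p.1 a) _).trans
    (add_le_add_left ((hf p.1).dist_le_mul _ hp _ ha) _)

end LimitVelocity

namespace IsClassicalSolution

variable {N : ℕ} {F : EuclideanSpace ℝ (Fin N) → EuclideanSpace ℝ (Fin N)}
  {x₀ : EuclideanSpace ℝ (Fin N)} {x : ℝ → EuclideanSpace ℝ (Fin N)}

theorem derivWithin_eq (h : IsClassicalSolution F x₀ x) {t : ℝ} (ht : 0 ≤ t) :
    derivWithin x (Ici 0) t = F (x t) :=
  (h.hasDeriv t ht).derivWithin (uniqueDiffOn_Ici 0 t ht)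

theorem continuousOn (h : IsClassicalSolution F x₀ x) : ContinuousOn x (Ici 0) :=
  fun t ht => (h.hasDeriv t ht).continuousWithinAt

theorem continuousOn_derivWithin (h : IsClassicalSolution F x₀ x) (hF : Continuous F) :
    ContinuousOn (derivWithin x (Ici 0)) (Ici 0) :=
  (hF.comp_continuousOn h.continuousOn).congr fun _ ht => h.derivWithin_eq ht

theorem eq_add_integral_derivWithin (h : IsClassicalSolution F x₀ x) (hF : Continuous F) {T : ℝ}
    (hT : 0 ≤ T) : x T = x₀ + ∫ t in (0 : ℝ)..T, derivWithin x (Ici 0) t := by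
  have hcont := (h.continuousOn_derivWithin hF).mono (Icc_subset_Ici_self : Icc 0 T ⊆ Ici 0)
  rw [intervalIntegral.integral_eq_sub_of_hasDerivAt_of_le hT
    (h.continuousOn.mono Icc_subset_Ici_self) (fun t ht => ?_)
    (hcont.intervalIntegrable_of_Icc hT), h.initial, add_sub_cancel]
  rw [h.derivWithin_eq ht.1.le]
  exact (h.hasDeriv t ht.1.le).hasDerivAt (Ici_mem_nhds ht.1)

theorem lipschitzOnWith (h : IsClassicalSolution F x₀ x) {C : ℝ≥0} (hC : ∀ y, ‖F y‖ ≤ C) :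
    LipschitzOnWith C x (Ici 0) :=
  (convex_Ici 0).lipschitzOnWith_of_nnnorm_hasDerivWithin_le h.hasDeriv fun _ _ => hC _

theorem norm_le (h : IsClassicalSolution F x₀ x) {C : ℝ≥0} (hC : ∀ y, ‖F y‖ ≤ C) {t : ℝ}
    (ht : 0 ≤ t) : ‖x t‖ ≤ ‖x₀‖ + C * t := by
  have hdist := (h.lipschitzOnWith hC).dist_le_mul t ht 0 self_mem_Ici
  rw [h.initial, dist_eq_norm, Real.dist_0_eq_abs, abs_of_nonneg ht] at hdist
  exact norm_le_norm_add_const_of_dist_le (by rwa [dist_eq_norm])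

theorem hasDerivAt_limit_mem_asymptoticHull {ι : Type*} {l : Filter ι} [l.NeBot]
    {G : ι → EuclideanSpace ℝ (Fin N) → EuclideanSpace ℝ (Fin N)}
    {u : ι → ℝ → EuclideanSpace ℝ (Fin N)} {v : EuclideanSpace ℝ (Fin N)} {C : ℝ≥0} {t : ℝ}
    (hu : ∀ i, IsClassicalSolution (G i) x₀ (u i)) (hC : ∀ i y, ‖G i y‖ ≤ C)
    (hlim : ∀ t, 0 ≤ t → Tendsto (u · t) l (𝓝 (x t))) (ht : 0 ≤ t) (hx : HasDerivAt x v t) :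
    v ∈ asymptoticHull l G (x t) := by
  intro w c hc
  have hjoint : Tendsto (fun p : ι × ℝ => u p.1 p.2) (l ×ˢ 𝓝[≥] t) (𝓝 (x t)) :=
    tendsto_prod_nhdsWithin_of_lipschitzOnWith
      (fun i => ((hu i).lipschitzOnWith (hC i)).mono (Ici_subset_Ici.2 ht)) self_mem_Ici (hlim t ht)
  obtain ⟨P, hP, Q, hQ, hPQ⟩ := eventually_prod_iff.1 ((tendsto_fst.prodMk hjoint).eventually hc)
  obtain ⟨b, htb, hb⟩ := mem_nhdsGE_iff_exists_Ico_subset.1 hQ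
  refine inner_le_of_eventually_inner_sub_le hx ?_
  filter_upwards [Ioo_mem_nhdsGT htb] with s hs
  refine le_of_tendsto (tendsto_const_nhds.inner
    ((hlim s (ht.trans hs.1.le)).sub (hlim t ht))) (hP.mono fun i hi => ?_)
  refine inner_sub_le_of_inner_deriv_le hs.1.le
    (fun τ hτ => ((hu i).hasDeriv τ (ht.trans hτ.1)).mono
      (Icc_subset_Ici_self.trans (Ici_subset_Ici.2 ht))) fun τ hτ => ?_
  exact hPQ hi (hb ⟨hτ.1.le, hτ.2.trans hs.2⟩)

end IsClassicalSolution

section Primitive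

theorem ae_restrict_Ici_of_forall_Ioo {p : ℝ → Prop}
    (h : ∀ T, 0 < T → ∀ᵐ t ∂(volume.restrict (Ioo (0 : ℝ) T)), p t) :
    ∀ᵐ t ∂(volume.restrict (Ici (0 : ℝ))), p t := by
  have hcover : Ioi (0 : ℝ) ⊆ ⋃ n : ℕ, Ioo (0 : ℝ) (n + 1) := fun t ht => by
    obtain ⟨n, hn⟩ := exists_nat_gt t
    exact mem_iUnion.2 ⟨n, ht, hn.trans (lt_add_one _)⟩
  rw [← restrict_Ioi_eq_restrict_Ici]
  refine ae_restrict_of_ae_restrict_of_subset hcover ?_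
  rw [ae_restrict_iUnion_iff]
  exact fun n => h _ n.cast_add_one_pos

theorem ae_hasDerivAt_add_integral {E : Type*} [NormedAddCommGroup E] [NormedSpace ℝ E]
    [CompleteSpace E] {v : ℝ → E} (hv : ∀ T, 0 < T → IntegrableOn v (Ioo 0 T)) (x₀ : E) :
    ∀ᵐ t ∂(volume.restrict (Ici (0 : ℝ))),
      HasDerivAt (fun t => x₀ + ∫ s in (0 : ℝ)..t, v s) (v t) t := by
  refine ae_restrict_Ici_of_forall_Ioo fun T hT => ?_
  have hint : IntervalIntegrable v volume 0 T :=
    (intervalIntegrable_iff_integrableOn_Ioo_of_le hT.le).2 (hv T hT)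
  refine (ae_restrict_iff' measurableSet_Ioo).2 ?_
  filter_upwards [hint.ae_hasDerivAt_integral] with t ht htT
  exact (ht (Icc_subset_uIcc (Ioo_subset_Icc_self htT)) 0 left_mem_uIcc).const_add x₀

end Primitive

namespace TendstoWeakStarLinf

variable {N : ℕ} {u : ℕ → ℝ → EuclideanSpace ℝ (Fin N)} {f g : ℝ → EuclideanSpace ℝ (Fin N)}

theorem of_tendsto (hmeas : ∀ n, AEStronglyMeasurable (u n) (volume.restrict (Ioi 0)))
    (hbdd : ∀ T, 0 < T → ∃ M, ∀ n, ∀ t ∈ Ioo 0 T, ‖u n t‖ ≤ M)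
    (hlim : ∀ t, 0 < t → Tendsto (u · t) atTop (𝓝 (f t))) : TendstoWeakStarLinf u f := by
  intro T hT φ hφ
  obtain ⟨M, hM⟩ := hbdd T hT
  have hmem : ∀ᵐ t ∂(volume.restrict (Ioo 0 T)), t ∈ Ioo 0 T := ae_restrict_mem measurableSet_Ioo
  refine tendsto_integral_of_dominated_convergence (fun t => ‖φ t‖ * M)
    (fun n => hφ.aestronglyMeasurable.inner ((hmeas n).mono_set Ioo_subset_Ioi_self))
    (hφ.norm.mul_const M) (fun n => hmem.mono fun t ht => ?_)
    (hmem.mono fun t ht => tendsto_const_nhds.inner (hlim t ht.1))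
  exact (norm_inner_le_norm _ _).trans (mul_le_mul_of_nonneg_left (hM n t ht) (norm_nonneg _))

theorem ae_eq (hf : TendstoWeakStarLinf u f) (hg : TendstoWeakStarLinf u g)
    (hfi : ∀ T, 0 < T → IntegrableOn f (Ioo 0 T)) (hgi : ∀ T, 0 < T → IntegrableOn g (Ioo 0 T)) :
    f =ᵐ[volume.restrict (Ici (0 : ℝ))] g := by
  refine ae_restrict_Ici_of_forall_Ioo fun T hT => ?_
  refine Integrable.ae_eq_of_forall_setIntegral_eq f g (hfi T hT) (hgi T hT) fun s hs _ => ?_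
  refine ext_inner_left ℝ fun w => ?_
  have htest (z : ℝ → EuclideanSpace ℝ (Fin N)) (hz : IntegrableOn z (Ioo 0 T)) :
      ∫ t in Ioo 0 T, ⟪s.indicator (fun _ => w) t, z t⟫_ℝ =
        ⟪w, ∫ t in s, z t ∂(volume.restrict (Ioo 0 T))⟫_ℝ := by
    rw [← integral_inner hz.integrableOn, ← integral_indicator hs]
    refine integral_congr_ae (Eventually.of_forall fun t => ?_)
    by_cases ht : t ∈ s <;> simp [ht]
  rw [← htest f (hfi T hT), ← htest g (hgi T hT)]
  have hw := (integrable_const w).indicator (μ := volume.restrict (Ioo 0 T)) hs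
  exact tendsto_nhds_unique (hf T hT _ hw) (hg T hT _ hw)

theorem tendsto_intervalIntegral (h : TendstoWeakStarLinf u f) {T : ℝ} (hT : 0 ≤ T)
    (hu : ∀ n, IntervalIntegrable (u n) volume 0 T) (hf : IntervalIntegrable f volume 0 T) :
    Tendsto (fun n => ∫ t in (0 : ℝ)..T, u n t) atTop (𝓝 (∫ t in (0 : ℝ)..T, f t)) := by
  rcases hT.eq_or_lt with rfl | hT'
  · simp
  rw [intervalIntegrable_iff_integrableOn_Ioo_of_le hT] at hf
  replace hu := fun n => (intervalIntegrable_iff_integrableOn_Ioo_of_le hT).1 (hu n)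
  simp only [intervalIntegral.integral_of_le hT, integral_Ioc_eq_integral_Ioo]
  refine (PiLp.homeomorph 2 _).isEmbedding.tendsto_nhds_iff.2 (tendsto_pi_nhds.2 fun i => ?_)
  have hcoord (z : ℝ → EuclideanSpace ℝ (Fin N)) (hz : IntegrableOn z (Ioo 0 T)) :
      ∫ t in Ioo 0 T, ⟪EuclideanSpace.single i (1 : ℝ), z t⟫_ℝ = (∫ t in Ioo 0 T, z t) i := by
    rw [integral_inner hz, EuclideanSpace.inner_single_left, map_one, one_mul]
  have hi := h T hT' _ (integrable_const (EuclideanSpace.single i (1 : ℝ)))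
  rw [hcoord f hf] at hi
  exact hi.congr fun n => hcoord (u n) (hu n)

end TendstoWeakStarLinf

section WeakStarLimit

variable {N : ℕ} {G : ℕ → EuclideanSpace ℝ (Fin N) → EuclideanSpace ℝ (Fin N)}
  {x₀ : EuclideanSpace ℝ (Fin N)} {u : ℕ → ℝ → EuclideanSpace ℝ (Fin N)}
  {θ v : ℝ → EuclideanSpace ℝ (Fin N)}

theorem MemW1InfLoc.integrableOn (h : MemW1InfLoc θ v) {T : ℝ} (hT : 0 < T) :
    IntegrableOn θ (Ioo 0 T) :=
  (h.memLp T hT).integrable le_top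

theorem MemW1InfLoc.integrableOn_deriv (h : MemW1InfLoc θ v) {T : ℝ} (hT : 0 < T) :
    IntegrableOn v (Ioo 0 T) :=
  (h.memLp_deriv T hT).integrable le_top

theorem tendsto_add_integral_of_tendstoWeakStarLinf_derivWithin
    (hu : ∀ n, IsClassicalSolution (G n) x₀ (u n)) (hG : ∀ n, Continuous (G n))
    (hv : ∀ T, 0 < T → IntegrableOn v (Ioo 0 T))
    (hlim : TendstoWeakStarLinf (fun n => derivWithin (u n) (Ici 0)) v) {t : ℝ} (ht : 0 ≤ t) :
    Tendsto (u · t) atTop (𝓝 (x₀ + ∫ s in (0 : ℝ)..t, v s)) := by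
  simp only [fun n => (hu n).eq_add_integral_derivWithin (hG n) ht]
  refine (hlim.tendsto_intervalIntegral ht (fun n => ?_) ?_).const_add x₀
  · exact (((hu n).continuousOn_derivWithin (hG n)).mono
      Icc_subset_Ici_self).intervalIntegrable_of_Icc ht
  · rcases ht.eq_or_lt with rfl | ht'
    · exact IntervalIntegrable.refl
    · exact (intervalIntegrable_iff_integrableOn_Ioo_of_le ht).2 (hv t ht')

theorem exists_isFilippovSolution_of_tendstoWeakStarW1InfLoc
    {F : EuclideanSpace ℝ (Fin N) → EuclideanSpace ℝ (Fin N)} {C : ℝ≥0}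
    (hu : ∀ n, IsClassicalSolution (G n) x₀ (u n)) (hG : ∀ n, Continuous (G n))
    (hC : ∀ n y, ‖G n y‖ ≤ C) (hF : ∀ y, asymptoticHull atTop G y ⊆ filippov F y)
    (hlim : TendstoWeakStarW1InfLoc u (fun n => derivWithin (u n) (Ici 0)) θ v) :
    (∀ᵐ t ∂(volume.restrict (Ici (0 : ℝ))), v t ∈ filippov F (θ t)) ∧
      ∃ x : ℝ → EuclideanSpace ℝ (Fin N), x =ᵐ[volume.restrict (Ici (0 : ℝ))] θ ∧
        IsFilippovSolution F x₀ x := by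
  have hv (T : ℝ) (hT : 0 < T) : IntegrableOn v (Ioo 0 T) := hlim.memLimit.integrableOn_deriv hT
  set x : ℝ → EuclideanSpace ℝ (Fin N) := fun t => x₀ + ∫ s in (0 : ℝ)..t, v s with hx
  have hux (t : ℝ) (ht : 0 ≤ t) : Tendsto (u · t) atTop (𝓝 (x t)) :=
    tendsto_add_integral_of_tendstoWeakStarLinf_derivWithin hu hG hv hlim.tendsto_deriv ht
  have hxLip : LipschitzOnWith C x (Ici 0) :=
    lipschitzOnWith_of_tendsto (fun n => (hu n).lipschitzOnWith (hC n)) hux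
  have hux' : TendstoWeakStarLinf u x := by
    refine .of_tendsto (fun n => ?_) (fun T _ => ⟨‖x₀‖ + C * T, fun n t ht => ?_⟩)
      fun t ht => hux t ht.le
    · exact ((hu n).continuousOn.mono Ioi_subset_Ici_self).aestronglyMeasurable measurableSet_Ioi
    · refine ((hu n).norm_le (hC n) ht.1.le).trans ?_
      gcongr
      exact ht.2.le
  have hxθ : x =ᵐ[volume.restrict (Ici (0 : ℝ))] θ :=
    hux'.ae_eq hlim.tendsto
      (fun T _ => ((hxLip.continuousOn.mono Icc_subset_Ici_self).integrableOn_Icc).mono_set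
        Ioo_subset_Icc_self)
      fun T hT => hlim.memLimit.integrableOn hT
  have hderiv : ∀ᵐ t ∂(volume.restrict (Ici (0 : ℝ))),
      HasDerivAt x (v t) t ∧ v t ∈ filippov F (x t) := by
    filter_upwards [ae_hasDerivAt_add_integral hv x₀, ae_restrict_mem measurableSet_Ici]
      with t hxt ht
    exact ⟨hxt, hF _ (IsClassicalSolution.hasDerivAt_limit_mem_asymptoticHull hu hC hux ht hxt)⟩
  refine ⟨?_, x, hxθ, by simp [hx], fun T hT => ?_, hderiv.mono fun t ht => ⟨v t, ht.2, ht.1⟩⟩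
  · filter_upwards [hderiv, hxθ] with t ht hxt
    exact hxt ▸ ht.2
  · refine LipschitzOnWith.absolutelyContinuousOnInterval (K := C) (hxLip.mono ?_)
    rw [uIcc_of_le hT.le]
    exact Icc_subset_Ici_self

end WeakStarLimit

end SingularKuramoto

theorem mainTheorem8_general (N : ℕ) (Ω Θ₀ : EuclideanSpace ℝ (Fin N)) (K : ℝ)
    (Θ : ℝ → ℝ → EuclideanSpace ℝ (Fin N))
    (hΘ : ∀ ε, 0 < ε → IsClassicalSolution (regField Ω K (1 / 2) ε) Θ₀ (Θ ε)) :
    (∀ ε, 0 < ε → ∀ t, 0 ≤ t → ∀ i,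
      |derivWithin (Θ ε) (Ici 0) t i| ≤ Real.sqrt (∑ j, Ω j ^ 2) + |K|) ∧
    (∀ T, 0 < T → ∃ C, ∀ ε, 0 < ε → ∀ t ∈ Icc 0 T,
      ‖Θ ε t‖ ≤ C ∧ ‖derivWithin (Θ ε) (Ici 0) t‖ ≤ C) ∧
    (∀ (e : ℕ → ℝ) (θ v : ℝ → EuclideanSpace ℝ (Fin N)),
      (∀ n, 0 < e n) → Tendsto e atTop (𝓝 0) →
      TendstoWeakStarW1InfLoc (fun n => Θ (e n)) (fun n => derivWithin (Θ (e n)) (Ici 0)) θ v →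
      (∀ᵐ t ∂(volume.restrict (Ici (0 : ℝ))), v t ∈ filippov (singField Ω K (1 / 2)) (θ t)) ∧
      ∃ x : ℝ → EuclideanSpace ℝ (Fin N), x =ᵐ[volume.restrict (Ici (0 : ℝ))] θ ∧
        IsFilippovSolution (singField Ω K (1 / 2)) Θ₀ x) := by
  obtain ⟨C, hC⟩ : ∃ C : NNReal, ∀ ε y, ‖regField Ω K (1 / 2) ε y‖ ≤ C :=
    ⟨⟨√N * (‖Ω‖ + |K|), by positivity⟩,
      fun ε y => norm_field_le Ω y K (abs_regKernel_half_le_one ε)⟩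
  refine ⟨fun ε hε t ht i => ?_, fun T hT => ⟨‖Θ₀‖ + C * T + C, fun ε hε t ht => ⟨?_, ?_⟩⟩,
    fun e θ v he he0 hlim => ?_⟩
  · rw [(hΘ ε hε).derivWithin_eq ht, ← EuclideanSpace.real_norm_sq_eq,
      Real.sqrt_sq (norm_nonneg _)]
    exact abs_field_apply_le Ω _ K (abs_regKernel_half_le_one ε) i
  · calc ‖Θ ε t‖ ≤ ‖Θ₀‖ + C * t := (hΘ ε hε).norm_le (hC ε) ht.1
      _ ≤ ‖Θ₀‖ + C * T := by gcongr; exact ht.2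
      _ ≤ ‖Θ₀‖ + C * T + C := le_add_of_nonneg_right C.2
  · rw [(hΘ ε hε).derivWithin_eq ht.1]
    exact (hC ε _).trans (le_add_of_nonneg_left (by positivity))
  · exact exists_isFilippovSolution_of_tendstoWeakStarW1InfLoc (fun n => hΘ (e n) (he n))
      (fun n => continuous_field Ω K (continuous_regKernel (he n).ne' _)) (fun n => hC (e n))
      (fun y => asymptoticHull_regField_subset_filippov he0 Ω y K) hlim

theorem mainTheorem8 (N : ℕ) (Ω Θ₀ : EuclideanSpace ℝ (Fin N)) (K : ℝ) (hK : 0 ≤ K)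
    (Θ : ℝ → ℝ → EuclideanSpace ℝ (Fin N))
    (hΘ : ∀ ε, 0 < ε → IsClassicalSolution (regField Ω K (1 / 2) ε) Θ₀ (Θ ε)) :
    (∀ ε, 0 < ε → ∀ t, 0 ≤ t → ∀ i,
      |derivWithin (Θ ε) (Ici 0) t i| ≤ Real.sqrt (∑ j, Ω j ^ 2) + K) ∧
    (∀ T, 0 < T → ∃ C, ∀ ε, 0 < ε → ∀ t ∈ Icc 0 T,
      ‖Θ ε t‖ ≤ C ∧ ‖derivWithin (Θ ε) (Ici 0) t‖ ≤ C) ∧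
    (∀ (e : ℕ → ℝ) (θ v : ℝ → EuclideanSpace ℝ (Fin N)),
      (∀ n, 0 < e n) → Tendsto e atTop (𝓝 0) →
      TendstoWeakStarW1InfLoc (fun n => Θ (e n)) (fun n => derivWithin (Θ (e n)) (Ici 0)) θ v →
      (∀ᵐ t ∂(volume.restrict (Ici (0 : ℝ))), v t ∈ filippov (singField Ω K (1 / 2)) (θ t)) ∧
      ∃ x : ℝ → EuclideanSpace ℝ (Fin N), x =ᵐ[volume.restrict (Ici (0 : ℝ))] θ ∧
        IsFilippovSolution (singField Ω K (1 / 2)) Θ₀ x) := by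
  simpa only [abs_of_nonneg hK] using mainTheorem8_general N Ω Θ₀ K Θ hΘ
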